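/- Call a subset $A$ of a topological space $X$ a co-zero set if $A=\varphi^{-1}((0,1])$ for some continuous $\varphi:X\to[0,1]$. Call $X$ a strong PP-space if for every dense set $D\subseteq X$ there exist a sequence $\bigl((U_{i,n}:i\in I_n)\bigr)_{n=1}^\infty$ of locally finite covers of $X$ by co-zero sets and a sequence $\bigl((x_{i,n}:i\in I_n)\bigr)_{n=1}^\infty$ of families of points of $D$ such that, for every $x\in X$ and all indices $i_n\in I_n$ with $x\in U_{i_n,n}$ for every $n$, one has $x_{i_n,n}\to x$ as $n\to\infty$. Call a topological space $Z$ strongly $\sigma$-metrizable with stratification $(Z_n)_{n=1}^\infty$ if $Z_1\subseteq Z_2\subseteq\cdots$ are closed metrizable subspaces of $Z$ with $Z=\bigcup_{n} Z_n$, and for every convergent sequence $(z_k)_{k=1}^\infty$ in $Z$ there is an $n$ with $\{z_k:k\in\mathbb N\}\subseteq Z_n$. **Theorem.** Let $X$ be a strong PP-space, let $Y$ be any topological space, and let $Z$ be a contractible regular strongly $\sigma$-metrizable space with a stratification $(Z_n)_{n=1}^\infty$ such that every $Z_n$ is metrizable, separable, arcwise connected and locally arcwise connected. Let $f:X\times Y\to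 Z$ be vertically nearly separately continuous, that is, $x\mapsto f(x,y)$ is continuous on $X$ for every $y\in Y$, and there is a dense set $D\subseteq X$ such that $y\mapsto f(x,y)$ is continuous on $Y$ for every $x\in D$. Then $f$ is of the first Baire class: there is a sequence of continuous mappings $f_n:X\times Y\to Z$ with $f_n(p)\to f(p)$ for every $p\in X\times Y$. -/

import Mathlib

open Set Filter Topology

universe u v w

/-- A co-zero set: the preimage of `(0, 1]` under a continuous function `X → [0, 1]`. -/
def IsCozeroSubset {X : Type u} [TopologicalSpace X] (A : Set X) : Prop :=
  ∃ φ : C(X, unitInterval), A = {x | 0 < φ x}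

/-- A strong PP-space: for every dense set `D` there are a sequence of locally finite covers
`(U n i : i ∈ I n)` of `X` by co-zero sets and a sequence of families `(p n i : i ∈ I n)` of points
of `D` such that, for every point `x` and every choice of indices `i n` with `x ∈ U n (i n)` for
all `n`, the sequence `p n (i n)` converges to `x`. -/
def IsStrongPPSpace (X : Type u) [TopologicalSpace X] : Prop :=
  ∀ D : Set X, Dense D →
    ∃ (I : ℕ → Type u) (U : (n : ℕ) → I n → Set X) (p : (n : ℕ) → I n → X),
      (∀ n, LocallyFinite (U n)) ∧
      (∀ n, ⋃ i, U n i = univ) ∧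
      (∀ n i, IsCozeroSubset (U n i)) ∧
      (∀ n i, p n i ∈ D) ∧
      ∀ (x : X) (i : (n : ℕ) → I n), (∀ n, x ∈ U n (i n)) →
        Tendsto (fun n => p n (i n)) atTop (𝓝 x)

/-- `S` is a stratification witnessing that `Z` is σ-metrizable: an increasing sequence of closed
metrizable subspaces whose union is `Z`. -/
structure IsSigmaMetrizableWith (Z : Type u) [TopologicalSpace Z] (S : ℕ → Set Z) : Prop where
  monotone : Monotone S
  isClosed : ∀ n, IsClosed (S n)
  metrizable : ∀ n, TopologicalSpace.MetrizableSpace (S n)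
  iUnion_eq : ⋃ n, S n = univ

/-- Property `(*)`: all the terms of any convergent sequence lie in a single `S n`. -/
def HasPropertyStar {Z : Type u} [TopologicalSpace Z] (S : ℕ → Set Z) : Prop :=
  ∀ (z : ℕ → Z) (a : Z), Tendsto z atTop (𝓝 a) → ∃ n, range z ⊆ S n

/-- `Z` is strongly σ-metrizable with stratification `S`. -/
structure IsStronglySigmaMetrizableWith (Z : Type u) [TopologicalSpace Z] (S : ℕ → Set Z) : Prop
    extends IsSigmaMetrizableWith Z S where
  star : HasPropertyStar S

/-- `f : X × Y → Z` is vertically nearly separately continuous: `f (·, y)` is continuous for every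
`y`, and `f (x, ·)` is continuous for all `x` in some dense subset of `X`. -/
def IsVerticallyNearlySeparatelyContinuous {X : Type u} {Y : Type v} {Z : Type w}
    [TopologicalSpace X] [TopologicalSpace Y] [TopologicalSpace Z] (f : X × Y → Z) : Prop :=
  (∀ y, Continuous fun x => f (x, y)) ∧
    ∃ D : Set X, Dense D ∧ ∀ x ∈ D, Continuous fun y => f (x, y)

/-- `f` is of the first Baire class: a pointwise limit of a sequence of continuous maps. -/
def IsFirstBaireClass {X : Type u} {Z : Type v} [TopologicalSpace X] [TopologicalSpace Z]
    (f : X → Z) : Prop :=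
  ∃ g : ℕ → X → Z, (∀ n, Continuous (g n)) ∧ ∀ x, Tendsto (fun n => g n x) atTop (𝓝 (f x))

/-! By continuity in `x`, `f (x, y)` is the limit of `f (p n (i n), y)` for any choice of indices
with `x ∈ U n (i n)`, and each `f (p n i, ·)` is continuous because `p n i ∈ D`. As the covers are
locally finite and co-zero, requiring `f (p n i, y) ∈ F` for all `i` with `x ∈ U n i` defines a zero
set of `X × Y` whenever `F` is closed: `Z` is regular and a countable union of second countable
pieces, hence perfectly normal.

Two facts follow. Preimages of open sets are functionally `Fσ`
(`preimage_eq_iUnion_approxPreimage`), and property `(*)` yields a countable cover by zero sets,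
each mapped by `f` into a single `S m` (`iUnion_iInter_approxPreimage_eq_univ`).

On one such zero set a Lebesgue–Hausdorff argument applies
(`isFirstBaireClass_of_isFunctionallyFσ_preimage`): `f` is approximated by values constant on
disjoint zero sets, joined continuously along short paths in `S m`. Contractibility of `Z` then
merges the pieces (`isFirstBaireClass_of_contractible`). Both constructions rest on
`exists_continuous_glue`. -/

/-! ### Zero sets and functionally `Fσ`-sets. -/

section ZeroSets

variable {P : Type*} [TopologicalSpace P] {Q : Type*} [TopologicalSpace Q]

/-- A zero set: the set of zeros of a nonnegative continuous function. -/
def IsZeroSet (A : Set P) : Prop :=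
  ∃ φ : P → ℝ, Continuous φ ∧ (∀ x, 0 ≤ φ x) ∧ A = {x | φ x = 0}

/-- A functionally `Fσ`-set: a countable union of zero sets. -/
def IsFunctionallyFσ (A : Set P) : Prop :=
  ∃ F : ℕ → Set P, (∀ n, IsZeroSet (F n)) ∧ A = ⋃ n, F n

namespace IsZeroSet

theorem of_continuous {φ : P → ℝ} (h : Continuous φ) : IsZeroSet {x | φ x = 0} :=
  ⟨fun x => |φ x|, by fun_prop, fun _ => abs_nonneg _, by ext; simp⟩

theorem of_continuous_le {φ : P → ℝ} (h : Continuous φ) (c : ℝ) : IsZeroSet {x | φ x ≤ c} := by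
  refine ⟨fun x => max (φ x - c) 0, by fun_prop, fun _ => le_max_right _ _, ?_⟩
  ext; simp

theorem of_continuous_ge {φ : P → ℝ} (h : Continuous φ) (c : ℝ) : IsZeroSet {x | c ≤ φ x} := by
  simpa using of_continuous_le h.neg (-c)

protected theorem univ : IsZeroSet (univ : Set P) := by
  simpa using of_continuous (P := P) (φ := fun _ => 0) continuous_const

protected theorem empty : IsZeroSet (∅ : Set P) := by
  simpa using of_continuous (P := P) (φ := fun _ => 1) continuous_const

theorem preimage {A : Set Q} (hA : IsZeroSet A) {g : P → Q} (hg : Continuous g) :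
    IsZeroSet (g ⁻¹' A) := by
  obtain ⟨φ, hφ, -, rfl⟩ := hA
  exact of_continuous (hφ.comp hg)

theorem inter {A B : Set P} (hA : IsZeroSet A) (hB : IsZeroSet B) : IsZeroSet (A ∩ B) := by
  obtain ⟨φ, hφ, hφ0, rfl⟩ := hA
  obtain ⟨ψ, hψ, hψ0, rfl⟩ := hB
  refine ⟨fun x => φ x + ψ x, by fun_prop, fun x => add_nonneg (hφ0 x) (hψ0 x), ?_⟩
  ext x
  exact (add_eq_zero_iff_of_nonneg (hφ0 x) (hψ0 x)).symm

theorem union {A B : Set P} (hA : IsZeroSet A) (hB : IsZeroSet B) : IsZeroSet (A ∪ B) := by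
  obtain ⟨φ, hφ, hφ0, rfl⟩ := hA
  obtain ⟨ψ, hψ, hψ0, rfl⟩ := hB
  refine ⟨fun x => φ x * ψ x, by fun_prop, fun x => mul_nonneg (hφ0 x) (hψ0 x), ?_⟩
  ext x
  exact mul_eq_zero.symm

theorem iUnion_finset {ι : Type*} (s : Finset ι) {A : ι → Set P} (hA : ∀ i ∈ s, IsZeroSet (A i)) :
    IsZeroSet (⋃ i ∈ s, A i) := by
  classical
  induction s using Finset.induction_on with
  | empty => simpa using IsZeroSet.empty
  | insert a s _ ih =>
    rw [Finset.set_biUnion_insert]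
    exact (hA a (by simp)).union (ih fun i hi => hA i (by simp [hi]))

/-- Truncating at `1` and weighting by `2 ^ -(n + 1)` gives a uniformly convergent sum of
nonnegative functions, which vanishes exactly where every term does. -/
theorem iInter {A : ℕ → Set P} (hA : ∀ n, IsZeroSet (A n)) : IsZeroSet (⋂ n, A n) := by
  choose φ hφ hφ0 hφA using hA
  have hb : ∀ n x, ‖min (φ n x) 1 * (1 / 2 / 2 ^ n)‖ ≤ 1 / 2 / (2 : ℝ) ^ n := by
    intro n x
    rw [Real.norm_of_nonneg (mul_nonneg (le_min (hφ0 n x) zero_le_one) (by positivity))]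
    exact mul_le_of_le_one_left (by positivity) (min_le_right _ _)
  have hn : ∀ x n, 0 ≤ min (φ n x) 1 * (1 / 2 / (2 : ℝ) ^ n) := fun x n =>
    mul_nonneg (le_min (hφ0 n x) zero_le_one) (by positivity)
  have hs : ∀ x, Summable fun n => min (φ n x) 1 * (1 / 2 / (2 : ℝ) ^ n) := fun x =>
    Summable.of_norm_bounded (summable_geometric_two' 1) fun n => hb n x
  refine ⟨fun x => ∑' n, min (φ n x) 1 * (1 / 2 / 2 ^ n),
    continuous_tsum (fun n => by fun_prop) (summable_geometric_two' 1) hb,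
    fun x => tsum_nonneg (hn x), ?_⟩
  ext x
  rw [mem_ofPred_eq, ← (hs x).hasSum_iff, hasSum_zero_iff_of_nonneg (hn x), funext_iff, mem_iInter]
  refine forall_congr' fun n => ?_
  rw [hφA n, mem_ofPred_eq, Pi.zero_apply, mul_eq_zero]
  constructor
  · intro h
    simp [h]
  · rintro (h | h)
    · rcases min_choice (φ n x) 1 with h' | h' <;> rw [h'] at h
      · exact h
      · norm_num at h
    · exact absurd h (by positivity)

/-- Disjoint zero sets are separated by a continuous function. -/
theorem exists_separating {A B : Set P} (hA : IsZeroSet A) (hB : IsZeroSet B) (h : Disjoint A B) :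
    ∃ u : P → ℝ, Continuous u ∧ (∀ x, 0 ≤ u x) ∧ (∀ x, u x ≤ 1) ∧ (∀ x ∈ A, u x = 1) ∧
      ∀ x ∈ B, u x = 0 := by
  obtain ⟨φ, hφ, hφ0, rfl⟩ := hA
  obtain ⟨ψ, hψ, hψ0, rfl⟩ := hB
  have hne : ∀ x, 0 < φ x + ψ x := by
    intro x
    refine lt_of_le_of_ne (add_nonneg (hφ0 x) (hψ0 x)) fun h0 => ?_
    have := (add_eq_zero_iff_of_nonneg (hφ0 x) (hψ0 x)).1 h0.symm
    exact disjoint_left.1 h this.1 this.2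
  refine ⟨fun x => ψ x / (φ x + ψ x), hψ.div₀ (hφ.add hψ) fun x => (hne x).ne',
    fun x => div_nonneg (hψ0 x) (hne x).le, fun x => ?_, fun x hx => ?_, fun x hx => ?_⟩
  · exact div_le_one_of_le₀ (by linarith [hφ0 x]) (hne x).le
  · have := hne x
    simp only [mem_ofPred_eq] at hx
    simp only [hx, zero_add] at this ⊢
    exact div_self this.ne'
  · simp only [mem_ofPred_eq] at hx
    simp [hx]

theorem isFunctionallyFσ {A : Set P} (hA : IsZeroSet A) : IsFunctionallyFσ A :=
  ⟨fun _ => A, fun _ => hA, (iUnion_const A).symm⟩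

theorem isFunctionallyFσ_compl {A : Set P} (hA : IsZeroSet A) : IsFunctionallyFσ Aᶜ := by
  obtain ⟨φ, hφ, hφ0, rfl⟩ := hA
  refine ⟨fun n => {x | 1 / ((n : ℝ) + 1) ≤ φ x}, fun n => of_continuous_ge hφ _, ?_⟩
  ext x
  simp only [mem_compl_iff, mem_ofPred_eq, mem_iUnion]
  constructor
  · intro h
    obtain ⟨n, hn⟩ := exists_nat_one_div_lt (lt_of_le_of_ne (hφ0 x) (Ne.symm h))
    exact ⟨n, hn.le⟩
  · rintro ⟨n, hn⟩ h
    rw [h] at hn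
    exact absurd hn (not_le.2 (by positivity))

end IsZeroSet

namespace IsFunctionallyFσ

theorem iUnion {A : ℕ → Set P} (hA : ∀ n, IsFunctionallyFσ (A n)) :
    IsFunctionallyFσ (⋃ n, A n) := by
  choose F hF hFA using hA
  refine ⟨fun k => F k.unpair.1 k.unpair.2, fun k => hF _ _, ?_⟩
  rw [iUnion_unpair F]
  exact iUnion_congr hFA

theorem inter {A B : Set P} (hA : IsFunctionallyFσ A) (hB : IsFunctionallyFσ B) :
    IsFunctionallyFσ (A ∩ B) := by
  obtain ⟨F, hF, rfl⟩ := hA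
  obtain ⟨G, hG, rfl⟩ := hB
  refine ⟨fun k => F k.unpair.1 ∩ G k.unpair.2, fun k => (hF _).inter (hG _), ?_⟩
  rw [iUnion_unpair fun i j => F i ∩ G j]
  ext x
  simp

theorem union {A B : Set P} (hA : IsFunctionallyFσ A) (hB : IsFunctionallyFσ B) :
    IsFunctionallyFσ (A ∪ B) := by
  obtain ⟨F, hF, rfl⟩ := hA
  obtain ⟨G, hG, rfl⟩ := hB
  exact ⟨fun k => F k ∪ G k, fun k => (hF k).union (hG k), (iUnion_union_distrib F G).symm⟩

/-- With an increasing exhaustion, a sequence of maps whose `n`-th term is controlled only on `F n`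
is eventually controlled at each point of `A`. -/
theorem exists_monotone {A : Set P} (hA : IsFunctionallyFσ A) :
    ∃ F : ℕ → Set P, (∀ n, IsZeroSet (F n)) ∧ Monotone F ∧ A = ⋃ n, F n := by
  obtain ⟨F, hF, rfl⟩ := hA
  refine ⟨accumulate F, fun n => ?_, monotone_accumulate, iUnion_accumulate.symm⟩
  have := IsZeroSet.iUnion_finset (Finset.range (n + 1)) (A := F) fun i _ => hF i
  simpa [accumulate_def, Nat.lt_succ_iff] using this

theorem disjointed {A : ℕ → Set P} (hA : ∀ n, IsZeroSet (A n)) (n : ℕ) :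
    IsFunctionallyFσ (disjointed A n) := by
  have h : _root_.disjointed A n = A n ∩ (⋃ i ∈ Finset.range n, A i)ᶜ := by
    rw [disjointed_eq_inter_compl]
    ext x
    simp
  rw [h]
  exact (hA n).isFunctionallyFσ.inter
    (IsZeroSet.iUnion_finset _ fun i _ => hA i).isFunctionallyFσ_compl

end IsFunctionallyFσ

/-- The union of a locally finite family of complements of zero sets is of the same kind. -/
theorem LocallyFinite.isZeroSet_compl_iUnion {ι : Type*} {A : ι → Set P} (hA : LocallyFinite A)
    (hz : ∀ i, IsZeroSet (A i)ᶜ) : IsZeroSet (⋃ i, A i)ᶜ := by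
  choose φ hφ hφ0 hφA using hz
  have hsupp : ∀ i, Function.support (φ i) = A i := fun i => by
    rw [← compl_compl (A i), hφA i]
    rfl
  have hlf : LocallyFinite fun i => Function.support (φ i) := by simpa only [hsupp] using hA
  refine ⟨fun x => ∑ᶠ i, φ i x, continuous_finsum hφ hlf, fun x => finsum_nonneg fun i => hφ0 i x, ?_⟩
  ext x
  simp only [mem_compl_iff, mem_iUnion, not_exists, mem_ofPred_eq]
  have hfin : (Function.support fun i => φ i x).Finite := by
    simpa [Function.support] using hlf.point_finite x
  have hmem : ∀ i, x ∉ A i ↔ φ i x = 0 := fun i => by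
    rw [← hsupp i, Function.notMem_support]
  simp only [hmem]
  constructor
  · intro h
    simp [h]
  · intro h i
    exact le_antisymm ((single_le_finsum i hfin fun j => hφ0 j x).trans h.le) (hφ0 i x)

end ZeroSets

/-! ### Gluing along homotopies, and contractible targets. -/

section Gluing

variable {P : Type*} [TopologicalSpace P] {Z : Type*} [TopologicalSpace Z]

/-- A continuous map can be modified, inside each of finitely many functionally open sets `O i`,
along a homotopy starting at it, so as to agree with the end of the homotopy near a zero set
`E i ⊆ O i`. -/
theorem exists_continuous_glue {ι : Type*} (s : Finset ι) {g : P → Z} (hg : Continuous g)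
    {E O : ι → Set P} (hE : ∀ i ∈ s, IsZeroSet (E i)) (hO : ∀ i ∈ s, IsZeroSet (O i)ᶜ)
    (hEO : ∀ i ∈ s, E i ⊆ O i) (hd : (s : Set ι).PairwiseDisjoint E) {h : ι → ℝ → P → Z}
    (hh : ∀ i ∈ s, Continuous fun q : ℝ × P => h i q.1 q.2)
    (h0 : ∀ i ∈ s, ∀ p ∈ O i, h i 0 p = g p) :
    ∃ (g' : P → Z) (O' : ι → Set P), Continuous g' ∧ (∀ i ∈ s, IsZeroSet (O' i)ᶜ) ∧
      (∀ i ∈ s, E i ⊆ O' i) ∧ (∀ i ∈ s, ∀ p ∈ O' i, g' p = h i 1 p) ∧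
      ∀ p, g' p = g p ∨ ∃ i ∈ s, p ∈ O i ∧ ∃ t ∈ Icc (0 : ℝ) 1, g' p = h i t p := by
  classical
  have hsep : ∀ i, ∃ u : P → ℝ, i ∈ s → Continuous u ∧ (∀ x, 0 ≤ u x) ∧ (∀ x, u x ≤ 1) ∧
      (∀ x ∈ E i, u x = 1) ∧ ∀ x ∈ (O i)ᶜ ∪ ⋃ j ∈ s.erase i, E j, u x = 0 := by
    intro i
    by_cases hi : i ∈ s
    · obtain ⟨u, hu⟩ := (hE i hi).exists_separating ((hO i hi).union
        (IsZeroSet.iUnion_finset (s.erase i) fun j hj => hE j (Finset.mem_of_mem_erase hj)))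
        (by
          rw [disjoint_union_right, disjoint_compl_right_iff_subset, disjoint_iUnion₂_right]
          refine ⟨hEO i hi, fun j hj => ?_⟩
          exact hd hi (Finset.mem_of_mem_erase hj) (Finset.ne_of_mem_erase hj).symm)
      exact ⟨u, fun _ => hu⟩
    · exact ⟨0, fun h => absurd h hi⟩
  choose u hu using hsep
  -- Subtracting the other `u j` makes the sets `{v i > 0}` pairwise disjoint, since `v i > 0`
  -- forces `u i > u j`, while keeping `v i = 1` on `E i`.
  let v : ι → P → ℝ := fun i p => u i p - ∑ j ∈ s.erase i, u j p
  have hv : ∀ i ∈ s, Continuous (v i) := fun i hi => (hu i hi).1.sub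
    (continuous_finsetSum _ fun j hj => (hu j (Finset.mem_of_mem_erase hj)).1)
  have hvE : ∀ i ∈ s, ∀ p ∈ E i, v i p = 1 := by
    intro i hi p hp
    have : ∑ j ∈ s.erase i, u j p = 0 := Finset.sum_eq_zero fun j hj =>
      (hu j (Finset.mem_of_mem_erase hj)).2.2.2.2 p (Or.inr (mem_biUnion (x := i)
        (by simp [hi, (Finset.ne_of_mem_erase hj).symm]) hp))
    simp only [v, this, (hu i hi).2.2.2.1 p hp, sub_zero]
  have hvO : ∀ i ∈ s, ∀ p, 0 < v i p → p ∈ O i := by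
    intro i hi p hp
    by_contra hpO
    have h1 : 0 ≤ ∑ j ∈ s.erase i, u j p := Finset.sum_nonneg fun j hj =>
      (hu j (Finset.mem_of_mem_erase hj)).2.1 p
    have h2 := (hu i hi).2.2.2.2 p (Or.inl hpO)
    simp only [v, h2] at hp
    linarith
  have hlt : ∀ i ∈ s, ∀ j ∈ s, i ≠ j → ∀ p, 0 < v i p → u j p < u i p := by
    intro i _ j hj hij p hp
    have := Finset.single_le_sum (f := fun j => u j p) (s := s.erase i)
      (fun k hk => (hu k (Finset.mem_of_mem_erase hk)).2.1 p)
      (Finset.mem_erase.2 ⟨hij.symm, hj⟩)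
    simp only [v] at hp
    linarith
  have huniq : ∀ i ∈ s, ∀ j ∈ s, ∀ p, 0 < v i p → 0 < v j p → i = j := by
    intro i hi j hj p hpi hpj
    by_contra hij
    exact lt_asymm (hlt i hi j hj hij p hpi) (hlt j hj i hi (Ne.symm hij) p hpj)
  -- The homotopy time is `0` for `v i ≤ 1 / 3` and `1` for `v i ≥ 2 / 3`: the first margin gives
  -- continuity at the edge of `{v i > 0}`, the second a neighbourhood of `E i` where the homotopy
  -- has ended.
  let φ : ι → P → ℝ := fun i p => max 0 (min 1 (3 * v i p - 1))
  let g' : P → Z := fun p =>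
    if hp : ∃ i ∈ s, 0 < v i p then h hp.choose (φ hp.choose p) p else g p
  have hg' : ∀ i ∈ s, ∀ p, 0 < v i p → g' p = h i (φ i p) p := by
    intro i hi p hp
    have hex : ∃ i ∈ s, 0 < v i p := ⟨i, hi, hp⟩
    have : hex.choose = i := huniq _ hex.choose_spec.1 i hi p hex.choose_spec.2 hp
    simp only [g', dif_pos hex, this]
  have hφ0 : ∀ i p, v i p ≤ 1 / 3 → φ i p = 0 := fun i p hp =>
    max_eq_left ((min_le_right _ _).trans (by linarith))
  have hg'g : ∀ p, (∀ i ∈ s, v i p ≤ 1 / 3) → g' p = g p := by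
    intro p hp
    by_cases hex : ∃ i ∈ s, 0 < v i p
    · obtain ⟨i, hi, hip⟩ := hex
      rw [hg' i hi p hip, hφ0 i p (hp i hi), h0 i hi p (hvO i hi p hip)]
    · simp only [g', dif_neg hex]
  refine ⟨g', fun i => {p | 2 / 3 < v i p}, ?_, fun i hi => ?_, fun i hi p hp => ?_,
    fun i hi p hp => ?_, fun p => ?_⟩
  · rw [continuous_iff_continuousAt]
    intro p
    by_cases hex : ∃ i ∈ s, 0 < v i p
    · obtain ⟨i, hi, hip⟩ := hex
      have hev : (fun p => h i (φ i p) p) =ᶠ[𝓝 p] g' :=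
        ((hv i hi).continuousAt.eventually_const_lt hip).mono fun q hq => (hg' i hi q hq).symm
      refine ContinuousAt.congr (Continuous.continuousAt ?_) hev
      have hφ : Continuous (φ i) := continuous_const.max (continuous_const.min
        ((continuous_const.mul (hv i hi)).sub continuous_const))
      exact (hh i hi).comp (hφ.prodMk continuous_id)
    · push Not at hex
      have hev : g =ᶠ[𝓝 p] g' := by
        have : ∀ᶠ q in 𝓝 p, ∀ i ∈ s, v i q < 1 / 3 :=
          (Finset.eventually_all s).2 fun i hi => (hv i hi).continuousAt.eventually_lt_const
            ((hex i hi).trans_lt (by norm_num))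
        exact this.mono fun q hq => (hg'g q fun i hi => (hq i hi).le).symm
      exact hg.continuousAt.congr hev
  · simpa [compl_ofPred] using IsZeroSet.of_continuous_le (hv i hi) (2 / 3)
  · simp only [mem_ofPred_eq, hvE i hi p hp]
    norm_num
  · have hp' : 2 / 3 < v i p := hp
    have : φ i p = 1 := by
      simp only [φ]
      rw [min_eq_left (by linarith), max_eq_right zero_le_one]
    rw [hg' i hi p (by linarith), this]
  · by_cases hex : ∃ i ∈ s, 0 < v i p
    · obtain ⟨i, hi, hip⟩ := hex
      exact Or.inr ⟨i, hi, hvO i hi p hip, φ i p,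
        ⟨le_max_left _ _, max_le zero_le_one (min_le_left _ _)⟩, hg' i hi p hip⟩
    · simp only [g', dif_neg hex, true_or]

/-- A map into a contractible space that is piecewise of the first Baire class, over a countable
cover by zero sets, is of the first Baire class. -/
theorem isFirstBaireClass_of_contractible [ContractibleSpace Z] {f : P → Z} {B : ℕ → Set P}
    (hB : ∀ m, IsZeroSet (B m)) (hBu : ⋃ m, B m = univ)
    (hf : ∀ m, ∃ g : ℕ → P → Z, (∀ n, Continuous (g n)) ∧
      ∀ p ∈ B m, Tendsto (fun n => g n p) atTop (𝓝 (f p))) : IsFirstBaireClass f := by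
  choose g hg hgf using hf
  obtain ⟨z₀, ⟨H⟩⟩ := id_nullhomotopic Z
  choose F hF hFm hFd using fun m => (IsFunctionallyFσ.disjointed hB m).exists_monotone
  -- `H` contracts the identity to `z₀`; running it backwards leads from the constant `z₀` to `g m
  -- n`.
  let h : ℕ → ℕ → ℝ → P → Z := fun n m t p => H (projIcc 0 1 zero_le_one (1 - t), g m n p)
  have key : ∀ n, ∃ g' : P → Z, Continuous g' ∧ ∀ m < n, ∀ p ∈ F m n, g' p = g m n p := by
    intro n
    obtain ⟨g', O', hg', -, hO', hgO', -⟩ := exists_continuous_glue (Finset.range n)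
      (g := fun _ => z₀) continuous_const (E := fun m => F m n) (O := fun _ => univ)
      (h := h n)
      (fun m _ => hF m n) (fun m _ => by simpa using IsZeroSet.empty) (fun m _ => subset_univ _)
      (fun i _ j _ hij => (disjoint_disjointed B hij).mono
        ((subset_iUnion (F i) n).trans (hFd i).ge) ((subset_iUnion (F j) n).trans (hFd j).ge))
      (fun m _ => H.continuous.comp ((continuous_projIcc.comp
        (continuous_const.sub continuous_fst)).prodMk ((hg m n).comp continuous_snd)))
      (fun m _ p _ => by simp [h])
    refine ⟨g', hg', fun m hm p hp => ?_⟩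
    rw [hgO' m (Finset.mem_range.2 hm) p (hO' m (Finset.mem_range.2 hm) hp)]
    simp [h]
  choose g' hg' hgF using key
  refine ⟨g', hg', fun p => ?_⟩
  have hp : p ∈ ⋃ m, disjointed B m := by rw [iUnion_disjointed, hBu]; trivial
  obtain ⟨m, hm⟩ := mem_iUnion.1 hp
  have hm' := hm
  rw [hFd m] at hm'
  obtain ⟨N, hN⟩ := mem_iUnion.1 hm'
  refine (hgf m p (disjointed_subset B m hm)).congr' ?_
  filter_upwards [eventually_ge_atTop N, eventually_gt_atTop m] with n hn hmn
  exact (hgF n m hmn p (hFm m hn hN)).symm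

end Gluing

/-! ### Separable metric, path connected and locally path connected targets. -/

section MetrizableRange

variable {P : Type*} [TopologicalSpace P] {M : Type*}

/-- Given a tree of zero sets `E k i` (the parent of `i` being `i.unpair.1`) and points `z k i`
joined inside the sets `W k j` along the edges of the tree, there are continuous maps `g k` taking
the value `z k i` on `E k i`, and moving only inside some `W k j` from `g k` to `g (k + 1)`. -/
theorem exists_continuous_seq_of_tree [TopologicalSpace M] (n : ℕ) {E : ℕ → ℕ → Set P}
    {W : ℕ → ℕ → Set M} {z : ℕ → ℕ → M} (hE : ∀ k i, IsZeroSet (E k i))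
    (hd : ∀ k, Pairwise (Function.onFun Disjoint (E k)))
    (hsub : ∀ k i, E (k + 1) i ⊆ E k i.unpair.1) (h0 : ∀ i, i ≠ 0 → E 0 i = ∅)
    (hz : ∀ k i, (E (k + 1) i).Nonempty → JoinedIn (W k i.unpair.1) (z k i.unpair.1) (z (k + 1) i)) :
    ∃ g : ℕ → P → M, (∀ k, Continuous (g k)) ∧ (∀ k, ∀ i < n, ∀ p ∈ E k i, g k p = z k i) ∧
      ∀ k p, g (k + 1) p = g k p ∨ ∃ j, g (k + 1) p ∈ W k j ∧ g k p ∈ W k j := by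
  classical
  -- Being constant on functionally open sets `O i` around the `E k i`, not just on these, leaves
  -- room for the next gluing.
  let State : ℕ → Type _ := fun k => {g : P → M // Continuous g ∧ ∃ O : ℕ → Set P,
    ∀ i < n, IsZeroSet (O i)ᶜ ∧ E k i ⊆ O i ∧ ∀ p ∈ O i, g p = z k i}
  have init : State 0 := by
    refine ⟨fun _ => z 0 0, continuous_const, fun i => if i = 0 then univ else ∅, fun i _ => ?_⟩
    by_cases hi : i = 0
    · subst hi
      simpa using IsZeroSet.empty
    · simpa [hi, h0 i hi] using IsZeroSet.univ
  have step : ∀ k (g : State k), ∃ g' : State (k + 1), ∀ p, g'.1 p = g.1 p ∨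
      ∃ j, g'.1 p ∈ W k j ∧ g.1 p ∈ W k j := by
    rintro k ⟨g, hg, O, hO⟩
    have hγ : ∀ i, ∃ γ : ℝ → M, (E (k + 1) i).Nonempty → Continuous γ ∧ γ 0 = z k i.unpair.1 ∧
        γ 1 = z (k + 1) i ∧ ∀ t ∈ Icc (0 : ℝ) 1, γ t ∈ W k i.unpair.1 := by
      intro i
      by_cases hi : (E (k + 1) i).Nonempty
      · refine ⟨(hz k i hi).somePath.extend, fun _ => ⟨Path.continuous_extend _, by simp, by simp,
          fun t ht => ?_⟩⟩
        rw [Path.extend_apply _ ht]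
        exact (hz k i hi).somePath_mem _
      · exact ⟨fun _ => z k 0, fun h => absurd h hi⟩
    choose γ hγ using hγ
    let s : Finset ℕ := (Finset.range n).filter fun i => (E (k + 1) i).Nonempty
    have hs : ∀ i, i ∈ s ↔ i < n ∧ (E (k + 1) i).Nonempty := fun i => by simp [s]
    -- A parent's index is at most that of its child, so truncating the tree at `n` keeps all
    -- ancestors.
    have hπ : ∀ i ∈ s, i.unpair.1 < n := fun i hi =>
      (Nat.unpair_left_le i).trans_lt ((hs i).1 hi).1
    obtain ⟨g', O', hg', hO'z, hEO', hg'1, hg'g⟩ := exists_continuous_glue s hg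
      (E := E (k + 1)) (O := fun i => O i.unpair.1) (h := fun i t _ => γ i t)
      (fun i _ => hE _ i) (fun i hi => (hO _ (hπ i hi)).1)
      (fun i hi => (hsub k i).trans (hO _ (hπ i hi)).2.1)
      (fun i _ j _ hij => hd (k + 1) hij)
      (fun i hi => (hγ i ((hs i).1 hi).2).1.comp continuous_fst)
      (fun i hi p hp => by
        rw [(hO _ (hπ i hi)).2.2 p hp]
        exact (hγ i ((hs i).1 hi).2).2.1)
    refine ⟨⟨g', hg', fun i => if i ∈ s then O' i else ∅, fun i hin => ?_⟩, fun p => ?_⟩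
    · by_cases hi : i ∈ s
      · simp only [hi, if_true]
        refine ⟨hO'z i hi, hEO' i hi, fun p hp => ?_⟩
        rw [hg'1 i hi p hp]
        exact (hγ i ((hs i).1 hi).2).2.2.1
      · have : E (k + 1) i = ∅ := by
          rw [← not_nonempty_iff_eq_empty]
          exact fun h => hi ((hs i).2 ⟨hin, h⟩)
        simpa [hi, this] using IsZeroSet.univ
    · rcases hg'g p with h | ⟨i, hi, hp, t, ht, hgt⟩
      · exact Or.inl h
      · refine Or.inr ⟨i.unpair.1, ?_, ?_⟩
        · change g' p ∈ _
          rw [hgt]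
          exact (hγ i ((hs i).1 hi).2).2.2.2 t ht
        · change g p ∈ _
          rw [(hO _ (hπ i hi)).2.2 p hp]
          exact (hz k i ((hs i).1 hi).2).source_mem
  choose next hnext using step
  let G : ∀ k, State k := fun k => Nat.rec init next k
  refine ⟨fun k => (G k).1, fun k => (G k).2.1, fun k i hi p hp => ?_, fun k p => hnext k (G k) p⟩
  obtain ⟨O, hO⟩ := (G k).2.2
  exact (hO i hi).2.2 p ((hO i hi).2.1 hp)

variable [MetricSpace M]

theorem exists_countable_cover_isPathConnected [TopologicalSpace.SeparableSpace M] [Nonempty M]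
    [LocallyPathConnectedSpace M] {ε : ℝ} (hε : 0 < ε) :
    ∃ W : ℕ → Set M, (∀ j, IsOpen (W j)) ∧ (∀ j, IsPathConnected (W j)) ∧
      (∀ j, ∀ x ∈ W j, ∀ y ∈ W j, dist x y ≤ ε) ∧ ⋃ j, W j = univ := by
  have := UniformSpace.secondCountable_of_separable M
  have h : ∀ x : M, ∃ U : Set M, IsOpen U ∧ IsPathConnected U ∧ x ∈ U ∧
      U ⊆ Metric.ball x (ε / 2) := by
    intro x
    obtain ⟨U, ⟨hUo, hxU, hU⟩, hUs⟩ := (isOpen_isPathConnected_basis x).mem_iff.1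
      (Metric.ball_mem_nhds x (half_pos hε))
    exact ⟨U, hUo, hU, hxU, hUs⟩
  choose U hUo hU hxU hUb using h
  obtain ⟨t, htc, htu⟩ := LindelofSpace.elim_nhds_subcover U fun x => (hUo x).mem_nhds (hxU x)
  have htn : t.Nonempty := by
    obtain ⟨x⟩ := ‹Nonempty M›
    obtain ⟨y, hy, -⟩ := mem_iUnion₂.1 (htu.ge (mem_univ x))
    exact ⟨y, hy⟩
  obtain ⟨c, rfl⟩ := htc.exists_eq_range htn
  refine ⟨fun j => U (c j), fun j => hUo _, fun j => hU _, fun j x hx y hy => ?_, ?_⟩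
  · have h1 := Metric.mem_ball.1 (hUb _ hx)
    have h2 := Metric.mem_ball.1 (hUb _ hy)
    have := dist_triangle_right x y (c j)
    linarith
  · simpa using htu

/-- A map into a separable metric space that is path connected and locally path connected, with
functionally `Fσ` preimages of open sets, is of the first Baire class. -/
theorem isFirstBaireClass_of_isFunctionallyFσ_preimage [TopologicalSpace.SeparableSpace M]
    [PathConnectedSpace M] [LocallyPathConnectedSpace M] {f : P → M}
    (hf : ∀ G : Set M, IsOpen G → IsFunctionallyFσ (f ⁻¹' G)) : IsFirstBaireClass f := by
  classical
  have hpart : ∀ k : ℕ, ∃ (W : ℕ → Set M) (F : ℕ → ℕ → Set P), (∀ j, IsPathConnected (W j)) ∧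
      (∀ j, ∀ x ∈ W j, ∀ y ∈ W j, dist x y ≤ (1 / 2) ^ (k + 1)) ∧
      (∀ j n, IsZeroSet (F j n)) ∧ (∀ j, Monotone (F j)) ∧
      (∀ n, Pairwise (Function.onFun Disjoint fun j => F j n)) ∧
      (∀ p, ∃ j n, p ∈ F j n) ∧ ∀ j n, ∀ p ∈ F j n, f p ∈ W j := by
    intro k
    obtain ⟨W, hWo, hWp, hWd, hWu⟩ := exists_countable_cover_isPathConnected (M := M)
      (ε := (1 / 2) ^ (k + 1)) (by positivity)
    choose A hA hAW using fun j => hf (W j) (hWo j)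
    -- The double family `A` is flattened so that `disjointed` applies; different pieces may share
    -- the same `W j`.
    let B : ℕ → Set P := fun i => A i.unpair.1 i.unpair.2
    choose F hF hFm hFB using fun i =>
      (IsFunctionallyFσ.disjointed (A := B) (fun i => hA _ _) i).exists_monotone
    have hFB' : ∀ i n, F i n ⊆ disjointed B i := fun i n => (subset_iUnion (F i) n).trans (hFB i).ge
    refine ⟨fun i => W i.unpair.1, F, fun _ => hWp _, fun _ => hWd _, hF, hFm,
      fun n i j hij => (disjoint_disjointed B hij).mono (hFB' i n) (hFB' j n), fun p => ?_,
      fun i n p hp => ?_⟩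
    · have hB : ⋃ i, disjointed B i = univ := by
        rw [iUnion_disjointed, iUnion_unpair A]
        simp_rw [← hAW]
        rw [← preimage_iUnion, hWu, preimage_univ]
      obtain ⟨i, hi⟩ := mem_iUnion.1 (hB.ge (mem_univ p))
      rw [hFB i] at hi
      exact ⟨i, mem_iUnion.1 hi⟩
    · have : p ∈ A i.unpair.1 i.unpair.2 := disjointed_subset B i (hFB' i n hp)
      exact (hAW i.unpair.1).ge (mem_iUnion.2 ⟨_, this⟩)
  choose W' F' hWp hWd hFz hFm hFd hFu hFW using hpart
  -- Node `i` at level `k + 1` refines its parent `i.unpair.1` by piece `i.unpair.2` of the `k`-th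
  -- partition. The last index is the exhaustion stage.
  let F : ℕ → ℕ → ℕ → Set P := fun k => Nat.rec (fun i _ => if i = 0 then univ else ∅)
    (fun k Fk i n => Fk i.unpair.1 n ∩ F' k i.unpair.2 n) k
  let W : ℕ → ℕ → Set M := fun k i => Nat.casesOn k univ fun k => W' k i.unpair.2
  have F0 : ∀ i n, F 0 i n = if i = 0 then univ else ∅ := fun _ _ => rfl
  have FS : ∀ k i n, F (k + 1) i n = F k i.unpair.1 n ∩ F' k i.unpair.2 n := fun _ _ _ => rfl
  have hz : ∀ k i n, IsZeroSet (F k i n) := by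
    intro k
    induction k with
    | zero =>
      intro i n
      rw [F0]
      split_ifs
      exacts [IsZeroSet.univ, IsZeroSet.empty]
    | succ k ih => exact fun i n => (ih _ _).inter (hFz _ _ _)
  have hm : ∀ k i, Monotone (F k i) := by
    intro k
    induction k with
    | zero => exact fun i => monotone_const
    | succ k ih => exact fun i m n hmn => inter_subset_inter (ih _ hmn) (hFm _ _ hmn)
  have hd : ∀ k n, Pairwise (Function.onFun Disjoint fun i => F k i n) := by
    intro k
    induction k with
    | zero =>
      intro n i j hij
      simp only [Function.onFun, F0]
      by_cases hi : i = 0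
      · have : j ≠ 0 := fun h => hij (hi.trans h.symm)
        simp [this]
      · simp [hi]
    | succ k ih =>
      intro n i j hij
      by_cases h1 : i.unpair.1 = j.unpair.1
      · have h2 : i.unpair.2 ≠ j.unpair.2 := fun h2 =>
          hij (Nat.pairEquiv.symm.injective (Prod.ext h1 h2))
        exact (hFd k n h2).mono inter_subset_right inter_subset_right
      · exact (ih n h1).mono inter_subset_left inter_subset_left
  have hu : ∀ k p, ∃ i n, p ∈ F k i n := by
    intro k p
    induction k with
    | zero => exact ⟨0, 0, by simp [F0]⟩
    | succ k ih =>
      obtain ⟨i, n, hp⟩ := ih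
      obtain ⟨j, m, hp'⟩ := hFu k p
      refine ⟨Nat.pair i j, max n m, ?_⟩
      rw [FS, Nat.unpair_pair]
      exact ⟨hm k i (le_max_left _ _) hp, hFm k j (le_max_right _ _) hp'⟩
  have hW : ∀ k i n, ∀ p ∈ F k i n, f p ∈ W k i := by
    intro k i n p hp
    cases k with
    | zero => trivial
    | succ k => exact hFW k _ n p hp.2
  have hWpc : ∀ k i, IsPathConnected (W k i) := by
    intro k i
    cases k with
    | zero => exact isPathConnected_univ
    | succ k => exact hWp k _
  have hWdist : ∀ k, 1 ≤ k → ∀ i, ∀ x ∈ W k i, ∀ y ∈ W k i, dist x y ≤ (1 / 2) ^ k := by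
    intro k hk i
    obtain ⟨k, rfl⟩ := Nat.exists_eq_add_of_le' hk
    exact hWd k _
  -- The value `z k i` does not depend on the stage `n`, so all the `g n k` aim at the same points.
  have hzex : ∀ k i, ∃ z : M, (∃ n, (F k i n).Nonempty) → ∃ n, ∃ p ∈ F k i n, f p = z := by
    intro k i
    by_cases h : ∃ n, (F k i n).Nonempty
    · obtain ⟨n, p, hp⟩ := h
      exact ⟨f p, fun _ => ⟨n, p, hp, rfl⟩⟩
    · exact ⟨Classical.arbitrary M, fun h' => absurd h' h⟩
  choose z hzF using hzex
  have hzW : ∀ k i n, (F k i n).Nonempty → z k i ∈ W k i := by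
    intro k i n h
    obtain ⟨m, p, hp, hpz⟩ := hzF k i ⟨n, h⟩
    exact hpz ▸ hW k i m p hp
  choose g hgc hgz hgW using fun n => exists_continuous_seq_of_tree n (E := fun k i => F k i n)
    (W := W) (z := z) (fun k i => hz k i n) (fun k => hd k n) (fun k i => inter_subset_left)
    (fun i hi => by simp [F0, hi])
    (fun k i h => (hWpc k i.unpair.1).joinedIn _
      (hzW k _ n (h.mono inter_subset_left)) _ (by
        obtain ⟨m, p, hp, hpz⟩ := hzF (k + 1) i ⟨n, h⟩
        exact hpz ▸ hW k _ m p hp.1))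
  -- The bound is the geometric sum of `(1 / 2) ^ j` over `k ≤ j < k + m`. Level `0` is excluded
  -- because `W 0 i = univ` has no diameter bound.
  have hdist : ∀ n p k, 1 ≤ k → ∀ m,
      dist (g n (k + m) p) (g n k p) ≤ 2 * (1 / 2) ^ k - 2 * (1 / 2) ^ (k + m) := by
    intro n p k hk m
    induction m with
    | zero => simp
    | succ m ih =>
      have h1 : dist (g n (k + m + 1) p) (g n (k + m) p) ≤ (1 / 2) ^ (k + m) := by
        rcases hgW n (k + m) p with h | ⟨j, h1, h2⟩
        · rw [h, dist_self]
          positivity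
        · exact hWdist (k + m) (by omega) j _ h1 _ h2
      have h2 := dist_triangle (g n (k + m + 1) p) (g n (k + m) p) (g n k p)
      have h3 : ((1 : ℝ) / 2) ^ (k + m + 1) = (1 / 2) ^ (k + m) * (1 / 2) := pow_succ _ _
      rw [← add_assoc, h3]
      linarith
  -- On the diagonal, once `p` lies in `F (k + 1) i n`, the map `g n (k + 1)` equals `z (k + 1) i`
  -- at `p`, and later levels move it by less than `(1 / 2) ^ k`.
  refine ⟨fun n => g n n, fun n => hgc n n, fun p => Metric.tendsto_atTop.2 fun ε hε => ?_⟩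
  obtain ⟨k, hk⟩ := exists_pow_lt_of_lt_one (show (0 : ℝ) < ε / 3 by positivity)
    (show (1 / 2 : ℝ) < 1 by norm_num)
  obtain ⟨i, N, hp⟩ := hu (k + 1) p
  refine ⟨max N (max (i + 1) (k + 1)), fun n hn => ?_⟩
  simp only [max_le_iff, ge_iff_le] at hn
  have hpn := hm (k + 1) i hn.1 hp
  obtain ⟨m, rfl⟩ := Nat.exists_eq_add_of_le hn.2.2
  have h1 := hdist (k + 1 + m) p (k + 1) (by omega) m
  rw [hgz _ (k + 1) i (by omega) p hpn] at h1
  have h2 := hWdist (k + 1) (by omega) i (z (k + 1) i) (hzW (k + 1) i _ ⟨p, hpn⟩) (f p)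
    (hW (k + 1) i _ p hpn)
  have h3 := dist_triangle (g (k + 1 + m) (k + 1 + m) p) (z (k + 1) i) (f p)
  have h4 : (0 : ℝ) < (1 / 2) ^ (k + 1 + m) := by positivity
  have h5 : ((1 : ℝ) / 2) ^ (k + 1) = (1 / 2) ^ k * (1 / 2) := pow_succ _ _
  linarith

end MetrizableRange

/-! ### Perfect normality of the target. -/

section SigmaMetrizable

variable {Z : Type*} [TopologicalSpace Z]

theorem HereditarilyLindelofSpace.of_iUnion_secondCountable {S : ℕ → Set Z}
    (hS : ∀ n, SecondCountableTopology (S n)) (hu : ⋃ n, S n = univ) :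
    HereditarilyLindelofSpace Z := by
  refine ⟨fun t _ => ?_⟩
  have ht : t = ⋃ n, ((↑) : S n → Z) '' ((↑) ⁻¹' t) := by
    simp_rw [Subtype.image_preimage_coe]
    rw [← iUnion_inter, hu, univ_inter]
  rw [ht]
  exact isLindelof_iUnion fun n =>
    (HereditarilyLindelofSpace.isLindelof _).image continuous_subtype_val

/-- In a regular hereditarily Lindelöf space, every open set is the union of the interiors of
countably many closed subsets. -/
theorem IsOpen.exists_iUnion_interior_isClosed [RegularSpace Z] [HereditarilyLindelofSpace Z]
    {G : Set Z} (hG : IsOpen G) :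
    ∃ F : ℕ → Set Z, (∀ k, IsClosed (F k)) ∧ (∀ k, F k ⊆ G) ∧ G = ⋃ k, interior (F k) := by
  have h : ∀ z : Z, ∃ F : Set Z, IsClosed F ∧ F ⊆ G ∧ (z ∈ G → F ∈ 𝓝 z) := by
    intro z
    by_cases hz : z ∈ G
    · obtain ⟨F, hF, hFc, hFG⟩ := exists_mem_nhds_isClosed_subset (hG.mem_nhds hz)
      exact ⟨F, hFc, hFG, fun _ => hF⟩
    · exact ⟨∅, isClosed_empty, empty_subset _, fun h => absurd h hz⟩
  choose F hFc hFG hFn using h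
  rcases G.eq_empty_or_nonempty with rfl | ⟨z₀, _⟩
  · exact ⟨fun _ => ∅, fun _ => isClosed_empty, fun _ => subset_rfl, by simp⟩
  have : Nonempty Z := ⟨z₀⟩
  obtain ⟨c, hc⟩ := (HereditarilyLindelofSpace.isLindelof G).indexed_countable_subcover
    (fun z => interior (F z)) (fun _ => isOpen_interior)
    (fun z hz => mem_iUnion.2 ⟨z, mem_interior_iff_mem_nhds.2 (hFn z hz)⟩)
  exact ⟨fun k => F (c k), fun k => hFc _, fun k => hFG _,
    hc.antisymm (iUnion_subset fun k => interior_subset.trans (hFG _))⟩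

/-- Normality comes from regular and Lindelöf; the hereditary Lindelöf property makes open sets
`Fσ`. This turns closed subsets of `Z` into zero sets. -/
theorem PerfectlyNormalSpace.of_regular_hereditarilyLindelof [RegularSpace Z]
    [HereditarilyLindelofSpace Z] : PerfectlyNormalSpace Z where
  closed_gdelta := by
    intro A hA
    obtain ⟨F, hFc, hFG, hF⟩ := hA.isOpen_compl.exists_iUnion_interior_isClosed
    have : A = ⋂ k, (F k)ᶜ := by
      rw [← compl_iUnion, eq_compl_comm]
      exact subset_antisymm (iUnion_subset hFG)
        (hF.trans_subset (iUnion_mono fun k => interior_subset))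
    rw [this]
    exact IsGδ.iInter_of_isOpen fun k => (hFc k).isOpen_compl

theorem IsClosed.isZeroSet [PerfectlyNormalSpace Z] {A : Set Z} (hA : IsClosed A) :
    IsZeroSet A := by
  obtain ⟨φ, rfl, hφ⟩ := perfectlyNormalSpace_iff_forall_isClosed_preimage_zero.1 ‹_› A hA
  exact ⟨φ, φ.continuous, fun x => (hφ x).1, rfl⟩

end SigmaMetrizable

theorem IsCozeroSubset.isZeroSet_compl {X : Type*} [TopologicalSpace X] {A : Set X}
    (hA : IsCozeroSubset A) : IsZeroSet Aᶜ := by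
  obtain ⟨φ, rfl⟩ := hA
  have h := IsZeroSet.of_continuous_le (continuous_subtype_val.comp φ.continuous) 0
  convert h using 1
  ext x
  simp only [mem_compl_iff, mem_ofPred_eq, not_lt, Function.comp_apply]
  rfl

/-! ### Describing `f` through its values over the points of `D`. -/

section ApproximatingPoints

variable {X Y Z : Type*} [TopologicalSpace Z]

/-- The points `(x, y)` such that `f (p i, y) ∈ F` for all `i` with `x ∈ U i`. -/
def approxPreimage {ι : Type*} (U : ι → Set X) (p : ι → X) (f : X × Y → Z) (F : Set Z) :
    Set (X × Y) :=
  {q | ∀ i, q.1 ∈ U i → f (p i, q.2) ∈ F}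

/-- The complement is the locally finite union of the sets `U i × {y | f (p i, y) ∉ F}`, each the
complement of a zero set. -/
theorem isZeroSet_approxPreimage [TopologicalSpace X] [TopologicalSpace Y] {ι : Type*}
    {U : ι → Set X} {p : ι → X} {f : X × Y → Z} {F : Set Z}
    (hU : LocallyFinite U) (hUz : ∀ i, IsCozeroSubset (U i))
    (hf : ∀ i, Continuous fun y => f (p i, y)) (hF : IsZeroSet F) :
    IsZeroSet (approxPreimage U p f F) := by
  let A : ι → Set (X × Y) := fun i => Prod.fst ⁻¹' U i ∩ {q | f (p i, q.2) ∉ F}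
  have hA : approxPreimage U p f F = (⋃ i, A i)ᶜ := by
    ext q
    simp [approxPreimage, A]
  rw [hA]
  refine LocallyFinite.isZeroSet_compl_iUnion
    ((hU.preimage_continuous continuous_fst).subset fun i => inter_subset_left) fun i => ?_
  have : (A i)ᶜ = Prod.fst ⁻¹' (U i)ᶜ ∪ (fun q : X × Y => f (p i, q.2)) ⁻¹' F := by
    ext q
    simp only [A, mem_compl_iff, mem_inter_iff, mem_preimage, mem_ofPred_eq, mem_union]
    tauto
  rw [this]
  exact ((hUz i).isZeroSet_compl.preimage continuous_fst).union
    (hF.preimage ((hf i).comp continuous_snd))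

variable {I : ℕ → Type*} {U : (n : ℕ) → I n → Set X} {p : (n : ℕ) → I n → X} {f : X × Y → Z}

theorem preimage_eq_iUnion_approxPreimage (hUc : ∀ n, ⋃ i, U n i = univ)
    (hlim : ∀ (q : X × Y) (i : (n : ℕ) → I n), (∀ n, q.1 ∈ U n (i n)) →
      Tendsto (fun n => f (p n (i n), q.2)) atTop (𝓝 (f q)))
    {G : Set Z} {F : ℕ → Set Z} (hF : ∀ k, IsClosed (F k)) (hFG : ∀ k, F k ⊆ G)
    (hG : G = ⋃ k, interior (F k)) :
    f ⁻¹' G = ⋃ k, ⋃ N : ℕ, ⋂ n, approxPreimage (U (N + n)) (p (N + n)) f (F k) := by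
  classical
  ext q
  have hcov : ∀ n, ∃ i, q.1 ∈ U n i := fun n => mem_iUnion.1 ((hUc n).ge (mem_univ q.1))
  simp only [mem_preimage, mem_iUnion, mem_iInter]
  constructor
  · intro hq
    rw [hG] at hq
    obtain ⟨k, hk⟩ := mem_iUnion.1 hq
    refine ⟨k, ?_⟩
    -- Picking a violating index whenever one exists makes convergence along this single choice
    -- control all indices at once.
    have hch : ∀ n, ∃ i, q.1 ∈ U n i ∧
        (f (p n i, q.2) ∈ F k → q ∈ approxPreimage (U n) (p n) f (F k)) := by
      intro n
      by_cases h : q ∈ approxPreimage (U n) (p n) f (F k)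
      · obtain ⟨i, hi⟩ := hcov n
        exact ⟨i, hi, fun _ => h⟩
      · simp only [approxPreimage, mem_ofPred_eq, not_forall] at h
        obtain ⟨i, hi, hF⟩ := h
        exact ⟨i, hi, fun h => absurd h hF⟩
    choose i hi hiF using hch
    obtain ⟨N, hN⟩ := eventually_atTop.1 ((hlim q i hi).eventually
      (mem_interior_iff_mem_nhds.1 hk))
    exact ⟨N, fun n => hiF _ (hN _ (Nat.le_add_right N n))⟩
  · rintro ⟨k, N, h⟩
    choose i hi using hcov
    refine hFG k ((hF k).mem_of_tendsto (hlim q i hi) ?_)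
    filter_upwards [eventually_ge_atTop N] with n hn
    obtain ⟨m, rfl⟩ := Nat.exists_eq_add_of_le hn
    exact h m _ (hi _)

theorem iUnion_iInter_approxPreimage_eq_univ [TopologicalSpace X]
    (hU : ∀ n, LocallyFinite (U n))
    (hUc : ∀ n, ⋃ i, U n i = univ)
    (hlim : ∀ (q : X × Y) (i : (n : ℕ) → I n), (∀ n, q.1 ∈ U n (i n)) →
      Tendsto (fun n => f (p n (i n), q.2)) atTop (𝓝 (f q)))
    {S : ℕ → Set Z} (hSm : Monotone S) (hSu : ⋃ n, S n = univ) (hS : HasPropertyStar S) :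
    ⋃ m, ⋂ n, approxPreimage (U n) (p n) f (S m) = univ := by
  classical
  refine eq_univ_of_forall fun q => ?_
  have hex : ∀ z, ∃ m, z ∈ S m := fun z => mem_iUnion.1 (hSu.ge (mem_univ z))
  -- Only finitely many `U n i` contain `q.1`, so some index puts its value in the latest stratum;
  -- property `(*)` along these indices then bounds all the others.
  have hworst : ∀ n, ∃ i, q.1 ∈ U n i ∧ ∀ j, q.1 ∈ U n j →
      Nat.find (hex (f (p n j, q.2))) ≤ Nat.find (hex (f (p n i, q.2))) := by
    intro n
    have hne : {i | q.1 ∈ U n i}.Nonempty := mem_iUnion.1 ((hUc n).ge (mem_univ q.1))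
    exact exists_max_image _ (fun i => Nat.find (hex (f (p n i, q.2))))
      ((hU n).point_finite q.1) hne
  choose i hi hmax using hworst
  obtain ⟨m, hm⟩ := hS _ _ (hlim q i hi)
  refine mem_iUnion.2 ⟨m, mem_iInter.2 fun n j hj => ?_⟩
  exact hSm ((hmax n j hj).trans (Nat.find_min' _ (hm ⟨n, rfl⟩)))
    (Nat.find_spec (hex (f (p n j, q.2))))

end ApproximatingPoints

/-! ### Localization to a stratum and proof of the theorem. -/

/-- A map with functionally `Fσ` preimages of open sets is a pointwise limit of continuous maps on
every zero set that it sends into a separable metrizable, path connected and locally path connected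
subspace. -/
theorem exists_tendsto_on_isZeroSet {P Z : Type*} [TopologicalSpace P] [TopologicalSpace Z]
    {f : P → Z} (hf : ∀ G : Set Z, IsOpen G → IsFunctionallyFσ (f ⁻¹' G)) {B : Set P}
    (hB : IsZeroSet B) {S : Set Z} (hBS : MapsTo f B S) [TopologicalSpace.MetrizableSpace S]
    [TopologicalSpace.SeparableSpace S] [PathConnectedSpace S] [LocallyPathConnectedSpace S] :
    ∃ g : ℕ → P → Z, (∀ n, Continuous (g n)) ∧
      ∀ p ∈ B, Tendsto (fun n => g n p) atTop (𝓝 (f p)) := by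
  classical
  let := TopologicalSpace.metrizableSpaceMetric S
  obtain ⟨z₀⟩ : Nonempty S := inferInstance
  -- Extending by a constant off `B` keeps preimages of open sets functionally `Fσ`, as `Bᶜ` is
  -- itself functionally `Fσ`.
  let f' : P → S := fun p => if hp : p ∈ B then ⟨f p, hBS hp⟩ else z₀
  have hf'B : ∀ p ∈ B, (f' p : Z) = f p := fun p hp => by simp [f', hp]
  have hf' : ∀ G : Set S, IsOpen G → IsFunctionallyFσ (f' ⁻¹' G) := by
    intro G hG
    obtain ⟨G', hG', rfl⟩ := isOpen_induced_iff.1 hG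
    have h1 := hB.isFunctionallyFσ.inter (hf G' hG')
    by_cases hz : (z₀ : Z) ∈ G'
    · convert h1.union hB.isFunctionallyFσ_compl using 1
      ext p
      by_cases hp : p ∈ B <;> simp [f', hp, hz]
    · convert h1 using 1
      ext p
      by_cases hp : p ∈ B <;> simp [f', hp, hz]
  obtain ⟨g, hg, hgf⟩ := isFirstBaireClass_of_isFunctionallyFσ_preimage hf'
  refine ⟨fun n p => g n p, fun n => continuous_subtype_val.comp (hg n), fun p hp => ?_⟩
  rw [← hf'B p hp]
  exact (continuous_subtype_val.tendsto _).comp (hgf p)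

theorem mainTheorem1 {X : Type u} {Y : Type v} {Z : Type w}
    [TopologicalSpace X] [TopologicalSpace Y] [TopologicalSpace Z]
    (hX : IsStrongPPSpace X)
    [ContractibleSpace Z] [RegularSpace Z]
    (S : ℕ → Set Z) (hS : IsStronglySigmaMetrizableWith Z S)
    (hsep : ∀ n, TopologicalSpace.SeparableSpace (S n))
    (hpc : ∀ n, PathConnectedSpace (S n))
    (hlpc : ∀ n, LocallyPathConnectedSpace (S n))
    (f : X × Y → Z) (hf : IsVerticallyNearlySeparatelyContinuous f) :
    IsFirstBaireClass f := by
  obtain ⟨hfx, D, hD, hfD⟩ := hf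
  obtain ⟨I, U, p, hU, hUc, hUz, hpD, hlim⟩ := hX D hD
  have hmet := hS.metrizable
  have hsc : ∀ n, SecondCountableTopology (S n) := fun n => by
    let := TopologicalSpace.metrizableSpaceMetric (S n)
    exact UniformSpace.secondCountable_of_separable (S n)
  have := HereditarilyLindelofSpace.of_iUnion_secondCountable hsc hS.iUnion_eq
  have : PerfectlyNormalSpace Z := .of_regular_hereditarilyLindelof
  have hflim : ∀ (q : X × Y) (i : (n : ℕ) → I n), (∀ n, q.1 ∈ U n (i n)) →
      Tendsto (fun n => f (p n (i n), q.2)) atTop (𝓝 (f q)) := fun q i hi =>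
    ((hfx q.2).tendsto q.1).comp (hlim q.1 i hi)
  have hzero : ∀ n (F : Set Z), IsClosed F → IsZeroSet (approxPreimage (U n) (p n) f F) :=
    fun n F hF => isZeroSet_approxPreimage (hU n) (hUz n) (fun i => hfD _ (hpD n i)) hF.isZeroSet
  have hpre : ∀ G : Set Z, IsOpen G → IsFunctionallyFσ (f ⁻¹' G) := by
    intro G hG
    obtain ⟨F, hFc, hFG, hF⟩ := hG.exists_iUnion_interior_isClosed
    rw [preimage_eq_iUnion_approxPreimage hUc hflim hFc hFG hF]
    exact .iUnion fun k => .iUnion fun N =>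
      (IsZeroSet.iInter fun n => hzero _ _ (hFc k)).isFunctionallyFσ
  have hBz : ∀ m, IsZeroSet (⋂ n, approxPreimage (U n) (p n) f (S m)) := fun m =>
    IsZeroSet.iInter fun n => hzero n _ (hS.isClosed m)
  refine isFirstBaireClass_of_contractible hBz
    (iUnion_iInter_approxPreimage_eq_univ hU hUc hflim hS.monotone hS.iUnion_eq hS.star)
    fun m => exists_tendsto_on_isZeroSet hpre (hBz m) (S := S m) fun q hq => ?_
  -- At such `q` all approximating values lie in the closed set `S m`, hence so does their limit `f
  -- q`.
  choose i hi using fun n => mem_iUnion.1 ((hUc n).ge (mem_univ q.1))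
  exact (hS.isClosed m).mem_of_tendsto (hflim q i hi)
    (.of_forall fun n => mem_iInter.1 hq n _ (hi n))
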